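/- Let $k\ge 1$ be an integer. For each $\lambda>0$ let $P_\lambda=\{X_1,X_2,\dots\}$ be a stationary Poisson process of intensity $\lambda$ in the plane $\mathbb{R}^2$ and, for $r>0$, let $V_k(\lambda,r)$ be the area of the set of those points of the unit square $[0,1]^2$ that lie in at most $k-1$ of the closed discs of radius $r$ centred at the points of $P_\lambda$. Let $c(\cdot)$ be a real-valued function and, for all large $\lambda$, let $r_\lambda>0$ be given by $$r_\lambda^2=\frac{\log\lambda+k\log\log\lambda+c(\lambda)}{\pi\lambda}.$$ Let $Z_\lambda=\{V_k(\lambda,r_\lambda)>0\}$ be the event that the unit square is not completely $k$-covered. (i) If $c(\lambda)\to\infty$ as $\lambda\to\infty$, then $\Pr(Z_\lambda)\to 0$ as $\lambda\to\infty$. (ii) If $c(\lambda)\to c\in\mathbb{R}$ as $\lambda\to\infty$, then there is a constant $c_1\in(0,1)$, depending only on $k$ and $c$, such that $\Pr(Z_\lambda)>c_1$ for all sufficiently large $\lambda$. -/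

import Mathlib

open MeasureTheory ProbabilityTheory Filter Topology

universe u

noncomputable section

/-- The number (with multiplicity, possibly infinite) of points of the random sequence
`X 0, X 1, …` that lie in the set `A`. -/
def pointCount {Ω : Type*} {d : ℕ} (X : ℕ → Ω → EuclideanSpace ℝ (Fin d))
    (A : Set (EuclideanSpace ℝ (Fin d))) (ω : Ω) : ℕ∞ :=
  Set.encard {i : ℕ | X i ω ∈ A}

/-- The random points `X 0, X 1, …` form a stationary Poisson process of intensity `l` in `ℝ^d`:
the number of points in a bounded Borel set `A` is Poisson distributed with mean `l * |A|`, and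
the numbers of points in finitely many pairwise disjoint bounded Borel sets are independent. -/
structure IsStationaryPoissonProcess {Ω : Type*} [MeasurableSpace Ω] {d : ℕ}
    (X : ℕ → Ω → EuclideanSpace ℝ (Fin d)) (l : ℝ) (P : Measure Ω) : Prop where
  measurable : ∀ i, Measurable (X i)
  poisson : ∀ A : Set (EuclideanSpace ℝ (Fin d)), MeasurableSet A → Bornology.IsBounded A →
    ∀ n : ℕ, P {ω | pointCount X A ω = n} = poissonMeasure (l * volume.real A).toNNReal {n}
  indep : ∀ (m : ℕ) (A : Fin m → Set (EuclideanSpace ℝ (Fin d))), (∀ j, MeasurableSet (A j)) →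
    (∀ j, Bornology.IsBounded (A j)) → Pairwise (fun i j => Disjoint (A i) (A j)) →
    iIndepFun (fun j => pointCount X (A j)) P

/-- The number of indices `i` for which the closed disc of radius `r` centred at `X i` covers the
point `x` of the plane. -/
def coverCount {Ω : Type*} (X : ℕ → Ω → EuclideanSpace ℝ (Fin 2)) (r : ℝ) (ω : Ω)
    (x : EuclideanSpace ℝ (Fin 2)) : ℕ∞ :=
  Set.encard {i : ℕ | x ∈ Metric.closedBall (X i ω) r}

/-- The unit square `[0,1]²`. -/
def unitSquare : Set (EuclideanSpace ℝ (Fin 2)) :=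
  {x | ∀ i, x i ∈ Set.Icc (0 : ℝ) 1}

/-- The `k`-vacancy in the unit square: the area of the part of the unit square which is covered
by at most `k - 1` of the discs of radius `r` centred at the points `X i`. -/
def kVacancy {Ω : Type*} (k : ℕ) (X : ℕ → Ω → EuclideanSpace ℝ (Fin 2)) (r : ℝ) (ω : Ω) :
    ENNReal :=
  volume {x ∈ unitSquare | coverCount X r ω x < k}

/-- The event that the `k`-vacancy in the unit square is positive. -/
def vacancyEvent {Ω : Type*} (k : ℕ) (X : ℕ → Ω → EuclideanSpace ℝ (Fin 2)) (r : ℝ) : Set Ω :=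
  {ω | 0 < kVacancy k X r ω}

/-- The radius `r ≥ 0` with `π l r² = log l + k log log l + c` (for `l` so large that the
right-hand side is nonnegative). -/
def coverRadius (k : ℕ) (c : ℝ) (l : ℝ) : ℝ :=
  Real.sqrt ((Real.log l + k * Real.log (Real.log l) + c) / (Real.pi * l))

end

/-! A point is covered fewer than `k` times with probability `p = poissonLT k μ`, where `μ = lπr² =
log l + k log log l + c`. Near the threshold `p` is of order `μ^(k-1) e^(-μ)`, and uncovered points
stay correlated over distances of order `1/(lr)`. There are thus about `(lr)² = lμ/π` nearly
independent sites, and the product `l μ^k e^(-μ)` is of order `e^(-c)`.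

(i) A grid of mesh about `1/(lr)` with slightly shrunken discs detects every vacancy, and the union
bound gives `O(e^(-c))` (`measure_vacancyEvent_le`, `measure_vacancyEvent_coverRadius_le`).

(ii) By Cauchy–Schwarz, `P(V > 0) ≥ (E V)² / E V²`. Here `E V = p`, and `E V² ≤ p (p + K/(lr)²)`,
because a second uncovered point leaves an independent lune nearly empty
(`exists_measure_pair_uncovered_le`, `exists_measure_vacancyEvent_ge`). -/

/-! ### Lower tails of the Poisson distribution -/

/-- The probability that a Poisson variable of mean `m` is smaller than `k`. -/
noncomputable def poissonLT (k : ℕ) (m : ℝ) : ℝ :=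
  ∑ j ∈ Finset.range k, Real.exp (-m) * m ^ j / j.factorial

theorem poissonLT_nonneg (k : ℕ) {m : ℝ} (hm : 0 ≤ m) : 0 ≤ poissonLT k m :=
  Finset.sum_nonneg fun j _ => by positivity

theorem poissonLT_ge_term {k j : ℕ} (hj : j < k) {m : ℝ} (hm : 0 ≤ m) :
    Real.exp (-m) * m ^ j / j.factorial ≤ poissonLT k m :=
  Finset.single_le_sum (f := fun j : ℕ => Real.exp (-m) * m ^ j / j.factorial)
    (fun j _ => by positivity) (Finset.mem_range.2 hj)

/-- Keeps the full factor `exp (-m)`, as the sharp threshold in (i) requires. -/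
theorem poissonLT_le_polynomial (k : ℕ) {m a : ℝ} (hm : 0 ≤ m) (hma : m ≤ a) (ha : 1 ≤ a) :
    poissonLT k m ≤ k * (Real.exp (-m) * a ^ (k - 1)) := by
  have : ∀ j ∈ Finset.range k,
      Real.exp (-m) * m ^ j / j.factorial ≤ Real.exp (-m) * a ^ (k - 1) := by
    intro j hj
    have h1 : m ^ j ≤ a ^ (k - 1) :=
      (pow_le_pow_left₀ hm hma j).trans
        (pow_le_pow_right₀ ha (by have := Finset.mem_range.1 hj; omega))
    have h2 : (1 : ℝ) ≤ j.factorial := by exact_mod_cast j.factorial_pos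
    calc _ ≤ Real.exp (-m) * m ^ j := div_le_self (by positivity) h2
      _ ≤ _ := by gcongr
  simpa [poissonLT] using Finset.sum_le_card_nsmul _ _ _ this

theorem poissonLT_le_exp_half (k : ℕ) {m : ℝ} (hm : 0 ≤ m) :
    poissonLT k m ≤ k * (2 ^ k * Real.exp (-(m / 2))) := by
  have : ∀ j ∈ Finset.range k,
      Real.exp (-m) * m ^ j / j.factorial ≤ 2 ^ k * Real.exp (-(m / 2)) := by
    intro j hj
    have h1 := Real.pow_div_factorial_le_exp (x := m / 2) (by positivity) j
    have h2 : Real.exp (-m) * m ^ j / j.factorial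
        = 2 ^ j * (Real.exp (-m) * ((m / 2) ^ j / j.factorial)) := by
      rw [div_pow]; field_simp
    have h3 : Real.exp (-m) * Real.exp (m / 2) = Real.exp (-(m / 2)) := by
      rw [← Real.exp_add]; ring_nf
    rw [h2, ← h3]
    gcongr
    · norm_num
    · exact (Finset.mem_range.1 hj).le
  simpa [poissonLT] using Finset.sum_le_card_nsmul _ _ _ this

/-- The exponent 3 exceeds the dimension 2, so the bound can be integrated over the plane when `m`
grows linearly with distance. The cruder decay `exp (-(m / 2))` suffices here. -/
theorem exists_poissonLT_le_rpow (k : ℕ) :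
    ∃ C : ℝ, 0 < C ∧ ∀ m : ℝ, 0 ≤ m → poissonLT k m ≤ C * (1 + m) ^ (-3 : ℝ) := by
  refine ⟨(k + 1) * (2 ^ k * (48 * Real.exp (1 / 2))), by positivity, fun m hm => ?_⟩
  refine (poissonLT_le_exp_half k hm).trans ?_
  have h1 := Real.pow_div_factorial_le_exp (x := (1 + m) / 2) (by positivity) 3
  have h2 : (1 + m) ^ (-3 : ℝ) = ((1 + m) ^ 3)⁻¹ := by
    rw [Real.rpow_neg (by positivity)]; norm_cast
  have h3 : Real.exp (-(m / 2)) ≤ 48 * Real.exp (1 / 2) * ((1 + m) ^ 3)⁻¹ := by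
    rw [← div_eq_mul_inv, le_div_iff₀ (by positivity)]
    have h4 : (1 + m) ^ 3 ≤ 48 * Real.exp ((1 + m) / 2) := by
      have : ((3 : ℕ).factorial : ℝ) = 6 := by norm_num [Nat.factorial]
      rw [this] at h1
      nlinarith
    calc _ ≤ Real.exp (-(m / 2)) * (48 * Real.exp ((1 + m) / 2)) := by gcongr
      _ = 48 * (Real.exp (-(m / 2)) * Real.exp ((1 + m) / 2)) := by ring
      _ = _ := by rw [← Real.exp_add]; ring_nf
  rw [h2]
  calc (k : ℝ) * (2 ^ k * Real.exp (-(m / 2)))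
      ≤ (k + 1) * (2 ^ k * (48 * Real.exp (1 / 2) * ((1 + m) ^ 3)⁻¹)) := by gcongr; linarith
    _ = _ := by ring

/-! ### Point counts: measurability, law and independence -/

theorem coverCount_eq_pointCount {Ω : Type*} (X : ℕ → Ω → EuclideanSpace ℝ (Fin 2)) (r : ℝ)
    (ω : Ω) (x : EuclideanSpace ℝ (Fin 2)) :
    coverCount X r ω x = pointCount X (Metric.closedBall x r) ω := by
  simp only [coverCount, pointCount, Metric.mem_closedBall_comm]

theorem pointCount_mono {Ω : Type*} {d : ℕ} (X : ℕ → Ω → EuclideanSpace ℝ (Fin d))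
    {A B : Set (EuclideanSpace ℝ (Fin d))} (h : A ⊆ B) (ω : Ω) :
    pointCount X A ω ≤ pointCount X B ω :=
  Set.encard_le_encard fun _ hi => h hi

theorem Set.natCast_le_encard_iff {α : Type*} {s : Set α} {k : ℕ} :
    (k : ℕ∞) ≤ s.encard ↔ ∃ t : Finset α, t.card = k ∧ ∀ i ∈ t, i ∈ s := by
  constructor
  · intro h
    obtain ⟨t, hts, ht⟩ := Set.exists_subset_encard_eq h
    have hfin : t.Finite := Set.finite_of_encard_eq_coe ht
    refine ⟨hfin.toFinset, ?_, fun i hi => hts (hfin.mem_toFinset.1 hi)⟩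
    rw [hfin.encard_eq_coe_toFinset_card] at ht
    exact_mod_cast ht
  · rintro ⟨t, rfl, h⟩
    rw [← Set.encard_coe_eq_coe_finsetCard]
    exact Set.encard_le_encard h

/-- The complement is a countable union, over `k`-element index sets, of finite intersections. -/
theorem measurableSet_encard_lt {α : Type*} [MeasurableSpace α] {S : ℕ → Set α}
    (hS : ∀ i, MeasurableSet (S i)) (k : ℕ) :
    MeasurableSet {a | Set.encard {i : ℕ | a ∈ S i} < k} := by
  have : {a | Set.encard {i : ℕ | a ∈ S i} < k}
      = (⋃ t ∈ {t : Finset ℕ | t.card = k}, ⋂ i ∈ t, S i)ᶜ := by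
    ext a
    simp only [Set.mem_ofPred_eq, Set.mem_compl_iff, Set.mem_iUnion, Set.mem_iInter, exists_prop]
    rw [← not_le, Set.natCast_le_encard_iff]
    rfl
  rw [this]
  exact (MeasurableSet.biUnion (Set.to_countable _)
    fun t _ => t.measurableSet_biInter fun i _ => hS i).compl

theorem measurableSet_pointCount_lt {Ω : Type*} [MeasurableSpace Ω] {d : ℕ}
    {X : ℕ → Ω → EuclideanSpace ℝ (Fin d)} (hX : ∀ i, Measurable (X i))
    {A : Set (EuclideanSpace ℝ (Fin d))} (hA : MeasurableSet A) (k : ℕ) :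
    MeasurableSet {ω | pointCount X A ω < k} :=
  measurableSet_encard_lt (fun i => hX i hA) k

theorem measurableSet_coverCount_lt {Ω : Type*} [MeasurableSpace Ω]
    {X : ℕ → Ω → EuclideanSpace ℝ (Fin 2)} (hX : ∀ i, Measurable (X i)) (r : ℝ) (k : ℕ) :
    MeasurableSet {z : Ω × EuclideanSpace ℝ (Fin 2) | coverCount X r z.1 z.2 < k} := by
  refine measurableSet_encard_lt
    (S := fun i => {z : Ω × EuclideanSpace ℝ (Fin 2) | z.2 ∈ Metric.closedBall (X i z.1) r})
    (fun i => ?_) k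
  have h : Measurable fun z : Ω × EuclideanSpace ℝ (Fin 2) => dist z.2 (X i z.1) :=
    measurable_snd.dist ((hX i).comp measurable_fst)
  exact measurableSet_le h measurable_const

namespace IsStationaryPoissonProcess

variable {Ω : Type*} [MeasurableSpace Ω] {d : ℕ} {X : ℕ → Ω → EuclideanSpace ℝ (Fin d)}
  {l : ℝ} {P : Measure Ω}

theorem measure_pointCount_lt (h : IsStationaryPoissonProcess X l P) (hl : 0 ≤ l)
    {A : Set (EuclideanSpace ℝ (Fin d))} (hA : MeasurableSet A) (hb : Bornology.IsBounded A)
    (k : ℕ) : P {ω | pointCount X A ω < k} = ENNReal.ofReal (poissonLT k (l * volume.real A)) := by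
  have h0 : 0 ≤ l * volume.real A := by positivity
  induction k with
  | zero => simp [poissonLT]
  | succ k ih =>
    have hu : {ω | pointCount X A ω < (k + 1 : ℕ)}
        = {ω | pointCount X A ω = k} ∪ {ω | pointCount X A ω < k} := by
      ext ω
      simp only [Set.mem_ofPred_eq, Set.mem_union]
      rw [Nat.cast_succ, ENat.lt_add_one_iff (ENat.natCast_ne_top k), le_iff_eq_or_lt]
    have hd : Disjoint {ω | pointCount X A ω = k} {ω | pointCount X A ω < k} := by
      rw [Set.disjoint_left]
      rintro ω h1 h2
      exact absurd h1 (ne_of_lt h2)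
    rw [hu, measure_union hd (measurableSet_pointCount_lt h.measurable hA k), ih, h.poisson A hA hb,
      poissonMeasure_singleton, ← ENNReal.ofReal_add (by positivity) (poissonLT_nonneg k h0),
      Real.coe_toNNReal _ h0, poissonLT, poissonLT, Finset.sum_range_succ, add_comm]

theorem measure_inter_pointCount_lt (h : IsStationaryPoissonProcess X l P)
    {A B : Set (EuclideanSpace ℝ (Fin d))} (hA : MeasurableSet A) (hAb : Bornology.IsBounded A)
    (hB : MeasurableSet B) (hBb : Bornology.IsBounded B) (hAB : Disjoint A B) (k : ℕ) :
    P ({ω | pointCount X A ω < k} ∩ {ω | pointCount X B ω < k})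
      = P {ω | pointCount X A ω < k} * P {ω | pointCount X B ω < k} := by
  have := h.indep 2 ![A, B] (by simp [Fin.forall_fin_two, hA, hB])
    (by simp [Fin.forall_fin_two, hAb, hBb])
    (by
      intro i j hij
      fin_cases i <;> fin_cases j <;> simp_all [hAB.symm])
  exact (this.indepFun (i := 0) (j := 1) (by decide)).measure_inter_preimage_eq_mul
    (Set.Iio (k : ℕ∞)) (Set.Iio (k : ℕ∞)) trivial trivial

end IsStationaryPoissonProcess

/-! ### Areas of discs, lunes and the unit square -/

theorem volume_real_closedBall_fin_two (x : EuclideanSpace ℝ (Fin 2)) {r : ℝ} (hr : 0 ≤ r) :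
    volume.real (Metric.closedBall x r) = Real.pi * r ^ 2 := by
  rw [measureReal_def, EuclideanSpace.volume_closedBall_fin_two]
  simp [ENNReal.toReal_ofReal hr, mul_comm, Real.pi_nonneg]

/-- Moving a disc by `v` repeatedly until it is disjoint from its original position bounds the area
of one step from below. -/
theorem volume_real_closedBall_diff_ge {x y : EuclideanSpace ℝ (Fin 2)} {r : ℝ} (hr : 0 < r)
    (hxy : dist x y ≤ 2 * r) :
    Real.pi * r * dist x y / 4
      ≤ volume.real (Metric.closedBall y r \ Metric.closedBall x r) := by
  rcases (dist_nonneg (x := x) (y := y)).eq_or_lt with h0 | h0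
  · simp [← h0]
  set v := y - x with hv
  have hnv : ‖v‖ = dist x y := by rw [hv, ← dist_eq_norm, dist_comm]
  let B : ℕ → Set (EuclideanSpace ℝ (Fin 2)) := fun n => Metric.closedBall (x + (n : ℝ) • v) r
  have hfin : ∀ m n, volume (B m \ B n) ≠ ⊤ := fun m n =>
    ((measure_mono Set.sdiff_subset).trans_lt measure_closedBall_lt_top).ne
  have hstep : ∀ n, volume.real (B (n + 1) \ B n)
      = volume.real (Metric.closedBall y r \ Metric.closedBall x r) := by
    intro n
    have : (fun z => z + (n : ℝ) • v) ⁻¹' (B (n + 1) \ B n)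
        = Metric.closedBall y r \ Metric.closedBall x r := by
      ext z
      simp only [B, Set.mem_preimage, Set.mem_sdiff, Metric.mem_closedBall, dist_eq_norm]
      have e1 : z + (n : ℝ) • v - (x + ((n + 1 : ℕ) : ℝ) • v) = z - y := by
        push_cast; rw [add_smul, one_smul, hv]; abel
      have e2 : z + (n : ℝ) • v - (x + (n : ℝ) • v) = z - x := by abel
      rw [e1, e2]
    rw [← this, measureReal_def, measureReal_def, measure_preimage_add_right]
  have hsum : ∀ n : ℕ, volume.real (B n \ B 0)
      ≤ n * volume.real (Metric.closedBall y r \ Metric.closedBall x r) := by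
    intro n
    induction n with
    | zero => simp
    | succ n ih =>
      have hsub : B (n + 1) \ B 0 ⊆ (B (n + 1) \ B n) ∪ (B n \ B 0) := by
        intro z hz
        by_cases h : z ∈ B n
        · exact Or.inr ⟨h, hz.2⟩
        · exact Or.inl ⟨hz.1, h⟩
      calc _ ≤ volume.real ((B (n + 1) \ B n) ∪ (B n \ B 0)) :=
            measureReal_mono hsub (measure_union_ne_top (hfin _ _) (hfin _ _))
        _ ≤ _ := measureReal_union_le _ _
        _ ≤ _ := by rw [hstep]; push_cast; linarith
  -- The least number of steps that exceeds a total displacement of `2 * r`. Since `dist x y ≤ 2 *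
  -- r`, the extra 1 at most doubles the quotient.
  set n := ⌊2 * r / dist x y⌋₊ + 1 with hn
  have hn1 : 2 * r / dist x y < n := by rw [hn]; exact_mod_cast Nat.lt_floor_add_one _
  have hn2 : (n : ℝ) ≤ 4 * r / dist x y := by
    have h1 : (n : ℝ) ≤ 2 * r / dist x y + 1 := by
      rw [hn]; push_cast; gcongr; exact Nat.floor_le (by positivity)
    have h2 : 1 ≤ 2 * r / dist x y := by rwa [one_le_div h0]
    calc _ ≤ 2 * r / dist x y + 2 * r / dist x y := by linarith
      _ = _ := by ring
  have hdisj : Disjoint (B n) (B 0) := by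
    apply Metric.closedBall_disjoint_closedBall
    rw [dist_eq_norm]
    have : x + (n : ℝ) • v - (x + ((0 : ℕ) : ℝ) • v) = (n : ℝ) • v := by simp
    rw [this, norm_smul, hnv, Real.norm_of_nonneg (by positivity)]
    rw [div_lt_iff₀ h0] at hn1
    linarith
  have hmain := hsum n
  rw [hdisj.sdiff_eq_left, volume_real_closedBall_fin_two _ hr.le] at hmain
  set D := volume.real (Metric.closedBall y r \ Metric.closedBall x r) with hD
  have hD0 : 0 ≤ D := measureReal_nonneg
  have h3 : Real.pi * r ^ 2 ≤ 4 * r / dist x y * D :=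
    hmain.trans (mul_le_mul_of_nonneg_right hn2 hD0)
  have h4 : Real.pi * r ^ 2 * dist x y ≤ 4 * r * D := by
    have := mul_le_mul_of_nonneg_right h3 h0.le
    calc _ ≤ _ := this
      _ = _ := by field_simp
  have h5 : Real.pi * r * dist x y ≤ 4 * D := by nlinarith
  linarith

theorem volume_unitSquare : volume unitSquare = 1 := by
  have h := (PiLp.volume_preserving_ofLp (Fin 2)).measure_preimage
    (s := Set.pi Set.univ fun _ : Fin 2 => Set.Icc (0 : ℝ) 1)
    (MeasurableSet.univ_pi fun _ => measurableSet_Icc).nullMeasurableSet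
  rw [volume_pi_pi] at h
  simp only [Real.volume_Icc, sub_zero, ENNReal.ofReal_one, Finset.prod_const_one] at h
  rw [← h]
  congr 1
  ext x
  simp [unitSquare, Pi.le_def, and_and_and_comm]

/-! ### Grid discretisation and the union bound -/

theorem exists_grid_point_near {N : ℕ} (hN : 0 < N) {x : EuclideanSpace ℝ (Fin 2)}
    (hx : x ∈ unitSquare) :
    ∃ i ∈ Finset.range (N + 1), ∃ j ∈ Finset.range (N + 1),
      dist x !₂[(i : ℝ) / N, (j : ℝ) / N] ≤ 2 / N := by
  have hN' : (0 : ℝ) < N := by exact_mod_cast hN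
  have key : ∀ t ∈ Set.Icc (0 : ℝ) 1,
      ∃ i ∈ Finset.range (N + 1), |t - (i : ℝ) / N| ≤ 1 / N := by
    intro t ht
    refine ⟨⌊t * N⌋₊, ?_, ?_⟩
    · rw [Finset.mem_range, Nat.lt_succ_iff]
      exact Nat.floor_le_of_le (by nlinarith [ht.2])
    · have h1 := Nat.floor_le (mul_nonneg ht.1 hN'.le)
      have h2 := Nat.lt_floor_add_one (t * N)
      rw [abs_of_nonneg (by rw [sub_nonneg, div_le_iff₀ hN']; exact h1), sub_le_iff_le_add,
        ← add_div, le_div_iff₀ hN']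
      linarith
  obtain ⟨i, hi, hi'⟩ := key _ (hx 0)
  obtain ⟨j, hj, hj'⟩ := key _ (hx 1)
  refine ⟨i, hi, j, hj, ?_⟩
  rw [EuclideanSpace.dist_eq, Real.sqrt_le_left (by positivity), Fin.sum_univ_two]
  simp only [Real.dist_eq, Matrix.cons_val_zero, Matrix.cons_val_one]
  have h1 := pow_le_pow_left₀ (abs_nonneg _) hi' 2
  have h2 := pow_le_pow_left₀ (abs_nonneg _) hj' 2
  calc _ ≤ (1 / (N : ℝ)) ^ 2 + (1 / (N : ℝ)) ^ 2 := add_le_add h1 h2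
    _ ≤ (2 / (N : ℝ)) ^ 2 := by
      rw [div_pow, div_pow, ← add_div]; gcongr; norm_num

/-- If `g` is within `δ` of a deficient point `x`, the disc of radius `r - δ` about `g` lies inside
the disc of radius `r` about `x`, so it also holds fewer than `k` process points. -/
theorem vacancyEvent_subset_of_grid {Ω : Type*} (k : ℕ) (X : ℕ → Ω → EuclideanSpace ℝ (Fin 2))
    (r : ℝ) {N : ℕ} (hN : 0 < N) {δ : ℝ} (hδ : 2 / N ≤ δ) :
    vacancyEvent k X r ⊆ ⋃ i ∈ Finset.range (N + 1), ⋃ j ∈ Finset.range (N + 1),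
      {ω | pointCount X (Metric.closedBall !₂[(i : ℝ) / N, (j : ℝ) / N] (r - δ)) ω < k} := by
  intro ω hω
  obtain ⟨x, hx, hxk⟩ := nonempty_of_measure_ne_zero (ne_of_gt hω)
  obtain ⟨i, hi, j, hj, hd⟩ := exists_grid_point_near hN hx
  simp only [Set.mem_iUnion, exists_prop]
  refine ⟨i, hi, j, hj, ?_⟩
  rw [coverCount_eq_pointCount] at hxk
  refine lt_of_le_of_lt (pointCount_mono X ?_ ω) hxk
  apply Metric.closedBall_subset_closedBall'
  rw [dist_comm]
  linarith

theorem vacancyEvent_antitone {Ω : Type*} (k : ℕ) (X : ℕ → Ω → EuclideanSpace ℝ (Fin 2)) :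
    Antitone (vacancyEvent k X) := by
  intro r s hrs ω hω
  refine lt_of_lt_of_le (Set.mem_ofPred_eq ▸ hω) (measure_mono ?_)
  rintro x ⟨hx1, hx2⟩
  refine ⟨hx1, lt_of_le_of_lt ?_ hx2⟩
  rw [coverCount_eq_pointCount, coverCount_eq_pointCount]
  exact pointCount_mono X (Metric.closedBall_subset_closedBall hrs) ω

theorem measure_vacancyEvent_le {Ω : Type*} [MeasurableSpace Ω]
    {X : ℕ → Ω → EuclideanSpace ℝ (Fin 2)} {l : ℝ} {P : Measure Ω}
    (h : IsStationaryPoissonProcess X l P) (hl : 0 ≤ l) (k : ℕ) (r : ℝ) {N : ℕ} (hN : 0 < N)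
    {δ : ℝ} (hδ : 2 / N ≤ δ) (hr : δ ≤ r) :
    P.real (vacancyEvent k X r) ≤ (N + 1) ^ 2 * poissonLT k (l * (Real.pi * (r - δ) ^ 2)) := by
  have hp : 0 ≤ poissonLT k (l * (Real.pi * (r - δ) ^ 2)) :=
    poissonLT_nonneg k (mul_nonneg hl (by positivity))
  refine ENNReal.toReal_le_of_le_ofReal (by positivity) ?_
  refine (measure_mono (vacancyEvent_subset_of_grid k X r hN hδ)).trans ?_
  have hb : ∀ g : EuclideanSpace ℝ (Fin 2),
      P {ω | pointCount X (Metric.closedBall g (r - δ)) ω < k}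
        = ENNReal.ofReal (poissonLT k (l * (Real.pi * (r - δ) ^ 2))) := by
    intro g
    rw [h.measure_pointCount_lt hl measurableSet_closedBall Metric.isBounded_closedBall,
      volume_real_closedBall_fin_two g (by linarith)]
  refine (measure_biUnion_finset_le _ _).trans ?_
  refine (Finset.sum_le_sum fun i _ => measure_biUnion_finset_le _ _).trans ?_
  simp only [hb, Finset.sum_const, Finset.card_range, nsmul_eq_mul]
  rw [ENNReal.ofReal_mul (by positivity), ENNReal.ofReal_pow (by positivity), ← mul_assoc]
  have : ((N + 1 : ℕ) : ENNReal) = ENNReal.ofReal ((N : ℝ) + 1) := by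
    rw [← ENNReal.ofReal_natCast]; push_cast; rfl
  rw [this, ← sq]

/-! ### Correlation of two uncovered points -/

/-- Translation removes `x`, and scaling by `b` in dimension 2 produces the factor `b⁻²`. -/
theorem exists_lintegral_one_add_mul_dist_le :
    ∃ K : ℝ, 0 < K ∧ ∀ b : ℝ, 0 < b → ∀ x : EuclideanSpace ℝ (Fin 2),
      ∫⁻ y, ENNReal.ofReal ((1 + b * dist x y) ^ (-3 : ℝ)) ≤ ENNReal.ofReal (K / b ^ 2) := by
  have hfin : ∫⁻ z : EuclideanSpace ℝ (Fin 2), ENNReal.ofReal ((1 + ‖z‖) ^ (-3 : ℝ)) < ⊤ :=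
    finite_integral_one_add_norm (by norm_num)
  set I := ∫⁻ z : EuclideanSpace ℝ (Fin 2), ENNReal.ofReal ((1 + ‖z‖) ^ (-3 : ℝ)) with hI
  refine ⟨I.toReal + 1, by positivity, fun b hb x => ?_⟩
  have hm : Measurable fun z : EuclideanSpace ℝ (Fin 2) =>
      ENNReal.ofReal ((1 + ‖z‖) ^ (-3 : ℝ)) := by fun_prop
  have h1 : ∫⁻ y, ENNReal.ofReal ((1 + b * dist x y) ^ (-3 : ℝ))
      = ∫⁻ y : EuclideanSpace ℝ (Fin 2), ENNReal.ofReal ((1 + ‖b • y‖) ^ (-3 : ℝ)) := by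
    rw [← lintegral_sub_right_eq_self
      (fun y : EuclideanSpace ℝ (Fin 2) => ENNReal.ofReal ((1 + ‖b • y‖) ^ (-3 : ℝ))) x]
    congr with y
    rw [norm_smul, Real.norm_of_nonneg hb.le, dist_comm, dist_eq_norm]
  have h2 : ∫⁻ y : EuclideanSpace ℝ (Fin 2), ENNReal.ofReal ((1 + ‖b • y‖) ^ (-3 : ℝ))
      = ENNReal.ofReal (|(b ^ 2)⁻¹|) * I := by
    rw [← lintegral_map hm (measurable_const_smul b), Measure.map_addHaar_smul _ hb.ne',
      lintegral_smul_measure, finrank_euclideanSpace_fin, smul_eq_mul]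
  rw [h1, h2, abs_of_pos (by positivity), ← ENNReal.ofReal_toReal hfin.ne,
    ← ENNReal.ofReal_mul (by positivity)]
  apply ENNReal.ofReal_le_ofReal
  rw [mul_comm, ← div_eq_mul_inv]
  gcongr
  rw [ENNReal.toReal_ofReal ENNReal.toReal_nonneg]
  linarith

theorem exists_measure_pair_uncovered_le (k : ℕ) :
    ∃ C : ℝ, 0 < C ∧ ∀ (Ω : Type u) [MeasurableSpace Ω] (X : ℕ → Ω → EuclideanSpace ℝ (Fin 2))
      (l : ℝ) (P : Measure Ω), IsStationaryPoissonProcess X l P → 0 < l → ∀ r : ℝ, 0 < r →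
      ∀ x y : EuclideanSpace ℝ (Fin 2),
        P ({ω | coverCount X r ω x < k} ∩ {ω | coverCount X r ω y < k})
          ≤ ENNReal.ofReal (poissonLT k (l * (Real.pi * r ^ 2)))
            * (ENNReal.ofReal (poissonLT k (l * (Real.pi * r ^ 2)))
              + ENNReal.ofReal (C * (1 + l * r * (Real.pi / 4) * dist x y) ^ (-3 : ℝ))) := by
  obtain ⟨C, hC, hCb⟩ := exists_poissonLT_le_rpow k
  refine ⟨C, hC, fun Ω _ X l P h hl r hr x y => ?_⟩
  have hball : ∀ z, P {ω | pointCount X (Metric.closedBall z r) ω < k}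
      = ENNReal.ofReal (poissonLT k (l * (Real.pi * r ^ 2))) := fun z => by
    rw [h.measure_pointCount_lt hl.le measurableSet_closedBall Metric.isBounded_closedBall,
      volume_real_closedBall_fin_two z hr.le]
  simp only [coverCount_eq_pointCount]
  -- For close points, the lune around `y` is disjoint from the disc around `x`, and its area is at
  -- least linear in the distance. For far points the discs themselves are disjoint and the events
  -- independent.
  rcases le_or_gt (dist x y) (2 * r) with hd | hd
  · have hbd : Bornology.IsBounded (Metric.closedBall y r \ Metric.closedBall x r) :=
      Metric.isBounded_closedBall.subset Set.sdiff_subset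
    have hms : MeasurableSet (Metric.closedBall y r \ Metric.closedBall x r) :=
      measurableSet_closedBall.diff measurableSet_closedBall
    calc _ ≤ P ({ω | pointCount X (Metric.closedBall x r) ω < k} ∩
          {ω | pointCount X (Metric.closedBall y r \ Metric.closedBall x r) ω < k}) :=
        measure_mono fun ω hω =>
          ⟨hω.1, lt_of_le_of_lt (pointCount_mono X Set.sdiff_subset ω) hω.2⟩
      _ = _ := h.measure_inter_pointCount_lt measurableSet_closedBall
          Metric.isBounded_closedBall hms hbd Set.disjoint_sdiff_right k
      _ ≤ _ := by
        rw [hball, h.measure_pointCount_lt hl.le hms hbd]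
        gcongr
        refine le_add_left (ENNReal.ofReal_le_ofReal ?_)
        refine (hCb _ (by positivity)).trans ?_
        refine mul_le_mul_of_nonneg_left ?_ hC.le
        refine Real.rpow_le_rpow_of_nonpos (by positivity) ?_ (by norm_num)
        have := mul_le_mul_of_nonneg_left (volume_real_closedBall_diff_ge hr hd) hl.le
        linarith
  · rw [h.measure_inter_pointCount_lt measurableSet_closedBall Metric.isBounded_closedBall
      measurableSet_closedBall Metric.isBounded_closedBall
      (Metric.closedBall_disjoint_closedBall (by linarith)), hball, hball]
    gcongr
    exact le_self_add

/-! ### First and second moments of the vacancy -/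

section Moments

variable {Ω : Type*} [MeasurableSpace Ω] {X : ℕ → Ω → EuclideanSpace ℝ (Fin 2)}

theorem kVacancy_eq_restrict (hX : ∀ i, Measurable (X i)) (k : ℕ) (r : ℝ) (ω : Ω) :
    kVacancy k X r ω
      = (volume.restrict unitSquare) (Prod.mk ω ⁻¹' {z | coverCount X r z.1 z.2 < k}) := by
  rw [Measure.restrict_apply (measurable_prodMk_left (measurableSet_coverCount_lt hX r k)),
    Set.inter_comm]
  rfl

theorem measurable_kVacancy (hX : ∀ i, Measurable (X i)) (k : ℕ) (r : ℝ) :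
    Measurable (kVacancy k X r) := by
  simp only [funext (kVacancy_eq_restrict hX k r)]
  exact measurable_measure_prodMk_left (measurableSet_coverCount_lt hX r k)

theorem lintegral_kVacancy (hX : ∀ i, Measurable (X i)) (P : Measure Ω) [SFinite P]
    (k : ℕ) (r : ℝ) :
    ∫⁻ ω, kVacancy k X r ω ∂P = ∫⁻ x in unitSquare, P {ω | coverCount X r ω x < k} := by
  have hS := measurableSet_coverCount_lt hX r k
  simp only [kVacancy_eq_restrict hX]
  rw [← Measure.prod_apply hS, Measure.prod_apply_symm hS]
  rfl

theorem lintegral_kVacancy_sq (hX : ∀ i, Measurable (X i)) (P : Measure Ω) [SFinite P]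
    (k : ℕ) (r : ℝ) :
    ∫⁻ ω, kVacancy k X r ω ^ 2 ∂P = ∫⁻ x in unitSquare, ∫⁻ y in unitSquare,
      P ({ω | coverCount X r ω x < k} ∩ {ω | coverCount X r ω y < k}) := by
  have hS := measurableSet_coverCount_lt hX r k
  have hsec : ∀ x, MeasurableSet {ω | coverCount X r ω x < k} := fun x =>
    measurable_prodMk_right hS
  have hV := measurable_kVacancy hX k r
  have h1 : ∀ ω, kVacancy k X r ω ^ 2 = ∫⁻ x in unitSquare,
      {z : Ω × EuclideanSpace ℝ (Fin 2) | coverCount X r z.1 z.2 < k}.indicator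
        (fun z => kVacancy k X r z.1) (ω, x) := by
    intro ω
    rw [sq]
    -- Only one factor is expanded as an integral over `x`; the other is handled after the swap by
    -- the first-moment formula for `P` restricted to the event that `x` is uncovered.
    nth_rewrite 2 [kVacancy_eq_restrict hX]
    rw [← lintegral_indicator_const (measurable_prodMk_left hS)]
    rfl
  simp only [h1]
  rw [lintegral_lintegral_swap (f := fun ω x =>
    {z : Ω × EuclideanSpace ℝ (Fin 2) | coverCount X r z.1 z.2 < k}.indicator
      (fun z => kVacancy k X r z.1) (ω, x))
    (((hV.comp measurable_fst).indicator hS).aemeasurable)]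
  refine lintegral_congr fun x => ?_
  have h2 : ∀ ω, {z : Ω × EuclideanSpace ℝ (Fin 2) | coverCount X r z.1 z.2 < k}.indicator
      (fun z => kVacancy k X r z.1) (ω, x)
      = {ω | coverCount X r ω x < k}.indicator (kVacancy k X r) ω := fun ω => rfl
  simp only [h2]
  rw [lintegral_indicator (hsec x), lintegral_kVacancy hX]
  refine lintegral_congr fun y => ?_
  rw [Measure.restrict_apply (hsec y), Set.inter_comm]

end Moments

/-- Cauchy–Schwarz applied to `f = f · 1_{f > 0}`. -/
theorem MeasureTheory.sq_lintegral_le_measure_pos_mul {α : Type*} [MeasurableSpace α]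
    (μ : Measure α) {f : α → ENNReal} (hf : Measurable f) :
    (∫⁻ a, f a ∂μ) ^ 2 ≤ μ {a | 0 < f a} * ∫⁻ a, f a ^ 2 ∂μ := by
  have hs : MeasurableSet {a | 0 < f a} := measurableSet_lt measurable_const hf
  have h := ENNReal.lintegral_mul_le_Lp_mul_Lq μ Real.HolderConjugate.two_two
    hf.aemeasurable ((measurable_one (α := ENNReal)).indicator hs).aemeasurable
  have h1 : ∀ a, (f * {a | 0 < f a}.indicator (1 : α → ENNReal)) a = f a := by
    intro a
    by_cases ha : 0 < f a
    · simp [Set.indicator, ha]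
    · have : f a = 0 := by simpa using ha
      simp [this]
  have h2 : ∀ a, ({a | 0 < f a}.indicator (1 : α → ENNReal) a) ^ (2 : ℝ)
      = {a | 0 < f a}.indicator 1 a := by
    intro a
    by_cases ha : 0 < f a <;> simp [Set.indicator, ha]
  simp only [h1, h2, lintegral_indicator_one hs, ENNReal.rpow_two] at h
  have h3 := pow_le_pow_left₀ zero_le h 2
  rw [mul_pow] at h3
  have h4 : ∀ a : ENNReal, (a ^ (1 / 2 : ℝ)) ^ 2 = a := fun a => by
    rw [← ENNReal.rpow_natCast, ← ENNReal.rpow_mul]; norm_num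
  rw [h4, h4, mul_comm] at h3
  exact h3

theorem exists_measure_vacancyEvent_ge (k : ℕ) :
    ∃ K : ℝ, 0 < K ∧ ∀ (Ω : Type u) [MeasurableSpace Ω] (X : ℕ → Ω → EuclideanSpace ℝ (Fin 2))
      (l : ℝ) (P : Measure Ω) [IsProbabilityMeasure P], IsStationaryPoissonProcess X l P → 0 < l →
      ∀ r : ℝ, 0 < r → 0 < poissonLT k (l * (Real.pi * r ^ 2)) →
        poissonLT k (l * (Real.pi * r ^ 2))
          ≤ P.real (vacancyEvent k X r)
            * (poissonLT k (l * (Real.pi * r ^ 2)) + K / (l * r) ^ 2) := by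
  obtain ⟨C, hC, hpair⟩ := exists_measure_pair_uncovered_le.{u} k
  obtain ⟨K, hK, hint⟩ := exists_lintegral_one_add_mul_dist_le
  refine ⟨C * K / (Real.pi / 4) ^ 2, by positivity, fun Ω _ X l P _ h hl r hr hp => ?_⟩
  specialize hpair Ω X l P h hl r hr
  set p := poissonLT k (l * (Real.pi * r ^ 2)) with hpdef
  have h1 : ∫⁻ ω, kVacancy k X r ω ∂P = ENNReal.ofReal p := by
    rw [lintegral_kVacancy h.measurable]
    have : ∀ x, P {ω | coverCount X r ω x < k} = ENNReal.ofReal p := fun x => by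
      simp only [coverCount_eq_pointCount]
      rw [h.measure_pointCount_lt hl.le measurableSet_closedBall Metric.isBounded_closedBall,
        volume_real_closedBall_fin_two x hr.le]
    simp [this, volume_unitSquare]
  have h2 : ∫⁻ ω, kVacancy k X r ω ^ 2 ∂P
      ≤ ENNReal.ofReal (p * (p + C * K / (Real.pi / 4) ^ 2 / (l * r) ^ 2)) := by
    rw [lintegral_kVacancy_sq h.measurable]
    have hb : 0 < l * r * (Real.pi / 4) := by positivity
    have h3 : ∀ x : EuclideanSpace ℝ (Fin 2), ∫⁻ y in unitSquare,
        P ({ω | coverCount X r ω x < k} ∩ {ω | coverCount X r ω y < k})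
        ≤ ENNReal.ofReal (p * (p + C * K / (Real.pi / 4) ^ 2 / (l * r) ^ 2)) := by
      intro x
      have hm : Measurable fun y : EuclideanSpace ℝ (Fin 2) =>
          ENNReal.ofReal ((1 + l * r * (Real.pi / 4) * dist x y) ^ (-3 : ℝ)) := by fun_prop
      calc _ ≤ ∫⁻ y in unitSquare, ENNReal.ofReal p * (ENNReal.ofReal p
              + ENNReal.ofReal (C * (1 + l * r * (Real.pi / 4) * dist x y) ^ (-3 : ℝ))) :=
            lintegral_mono fun y => hpair x y
        _ = ENNReal.ofReal p * (ENNReal.ofReal p + ENNReal.ofReal C * ∫⁻ y in unitSquare,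
              ENNReal.ofReal ((1 + l * r * (Real.pi / 4) * dist x y) ^ (-3 : ℝ))) := by
            simp only [ENNReal.ofReal_mul hC.le]
            rw [lintegral_const_mul _ (by fun_prop), lintegral_add_left measurable_const,
              lintegral_const_mul _ hm]
            simp [volume_unitSquare]
        _ ≤ ENNReal.ofReal p * (ENNReal.ofReal p
              + ENNReal.ofReal C * ENNReal.ofReal (K / (l * r * (Real.pi / 4)) ^ 2)) := by
            gcongr
            exact (setLIntegral_le_lintegral _ _).trans (hint _ hb x)
        _ = _ := by
            rw [← ENNReal.ofReal_mul hC.le, ← ENNReal.ofReal_add hp.le (by positivity),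
              ← ENNReal.ofReal_mul hp.le]
            congr 3
            field_simp
    calc _ ≤ ∫⁻ x in unitSquare,
          ENNReal.ofReal (p * (p + C * K / (Real.pi / 4) ^ 2 / (l * r) ^ 2)) :=
        lintegral_mono h3
      _ = _ := by simp [volume_unitSquare]
  have h3 := sq_lintegral_le_measure_pos_mul P (measurable_kVacancy h.measurable k r)
  rw [h1] at h3
  have h4 : ENNReal.ofReal p ^ 2 ≤ P (vacancyEvent k X r) *
      ENNReal.ofReal (p * (p + C * K / (Real.pi / 4) ^ 2 / (l * r) ^ 2)) :=
    h3.trans (mul_le_mul_right h2 _)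
  have h5 := ENNReal.toReal_mono
    (ENNReal.mul_ne_top (measure_ne_top _ _) ENNReal.ofReal_ne_top) h4
  rw [ENNReal.toReal_pow, ENNReal.toReal_mul, ENNReal.toReal_ofReal hp.le,
    ENNReal.toReal_ofReal (by positivity), ← measureReal_def] at h5
  refine le_of_mul_le_mul_left ?_ hp
  calc p * p = p ^ 2 := by ring
    _ ≤ _ := h5
    _ = _ := by ring

/-! ### The threshold radius and the two regimes -/

theorem coverRadius_mono (k : ℕ) {l : ℝ} (hl : 0 < l) : Monotone fun c => coverRadius k c l := by
  intro c d hcd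
  simp only [coverRadius]
  gcongr

theorem mul_coverRadius_sq {k : ℕ} {c l : ℝ} (hl : 0 < l)
    (h : 0 ≤ Real.log l + k * Real.log (Real.log l) + c) :
    l * (Real.pi * coverRadius k c l ^ 2) = Real.log l + k * Real.log (Real.log l) + c := by
  rw [coverRadius, Real.sq_sqrt (by positivity)]
  field_simp

/-- This explains the coefficient `k` of `log log l`: one power of `log l` comes from the number of
sites, and `k - 1` come from the Poisson tail. -/
theorem mul_exp_neg_mul_log_pow {k : ℕ} {c l : ℝ} (hl : 1 < l) :
    l * Real.exp (-(Real.log l + k * Real.log (Real.log l) + c)) * Real.log l ^ k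
      = Real.exp (-c) := by
  have hL : 0 < Real.log l := Real.log_pos hl
  have h : Real.exp (k * Real.log (Real.log l)) = Real.log l ^ k := by
    rw [← Real.log_pow, Real.exp_log (by positivity)]
  have e : Real.exp (-(Real.log l + k * Real.log (Real.log l) + c))
      = l⁻¹ * (Real.log l ^ k)⁻¹ * Real.exp (-c) := by
    rw [neg_add, neg_add, Real.exp_add, Real.exp_add, Real.exp_neg, Real.exp_neg (k * _), h,
      Real.exp_log (by linarith)]
  rw [e]
  field_simp

/-- The hypothesis `c ≤ log l` gives `μ ≤ (k + 2) log l`, so `μ ^ k` is comparable to `(log l) ^ k`;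
the hypothesis `4π ≤ log l` makes the grid scale smaller than the radius. -/
theorem measure_vacancyEvent_coverRadius_le {Ω : Type*} [MeasurableSpace Ω]
    {X : ℕ → Ω → EuclideanSpace ℝ (Fin 2)} {l : ℝ} {P : Measure Ω}
    (h : IsStationaryPoissonProcess X l P) {k : ℕ} (hk : 1 ≤ k) {c : ℝ} (hl : 1 < l)
    (hL : 4 * Real.pi ≤ Real.log l) (hc : 0 ≤ c) (hcL : c ≤ Real.log l) :
    P.real (vacancyEvent k X (coverRadius k c l))
      ≤ 4 / Real.pi * k * Real.exp (4 * Real.pi) * (k + 2) ^ k * Real.exp (-c) := by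
  have hpi := Real.pi_gt_three
  set L := Real.log l with hLdef
  set μ := L + k * Real.log L + c with hμ
  have hlogL : 0 ≤ Real.log L := Real.log_nonneg (by linarith)
  have hLμ : L ≤ μ := by
    have : 0 ≤ k * Real.log L := by positivity
    linarith
  have hμL : μ ≤ (k + 2) * L := by
    have : (k : ℝ) * Real.log L ≤ k * L :=
      mul_le_mul_of_nonneg_left (Real.log_le_self (by linarith)) (by positivity)
    linarith
  have hμ0 : 0 < μ := by linarith
  have hl0 : 0 < l := by linarith
  set r := coverRadius k c l with hr
  have hrμ : l * (Real.pi * r ^ 2) = μ := mul_coverRadius_sq hl0 hμ0.le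
  have hr0 : 0 < r := by
    rw [hr, coverRadius]
    exact Real.sqrt_pos.2 (by positivity)
  have hlr2 : 4 ≤ l * r ^ 2 := by
    have : Real.pi * (l * r ^ 2) = μ := by rw [← hrμ]; ring
    by_contra! hlt
    nlinarith
  have hlr : 2 ≤ l * r := by
    have : 4 ≤ (l * r) ^ 2 := by nlinarith
    nlinarith [mul_pos hl0 hr0]
  -- Shrinking the radius by this `δ` lowers the Poisson mean by at most `4π`, since `2π l r δ =
  -- 4π`; the cost is a constant factor.
  set δ := 2 / (l * r) with hδ
  have hlrδ : l * r * δ = 2 := by rw [hδ]; field_simp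
  have hδr : δ ≤ r := by rw [hδ, div_le_iff₀ (by positivity)]; nlinarith
  have hδ0 : 0 < δ := by positivity
  have hN : 0 < ⌈l * r⌉₊ := Nat.ceil_pos.2 (by positivity)
  have hNδ : 2 / (⌈l * r⌉₊ : ℝ) ≤ δ := by
    rw [hδ]; gcongr; exact Nat.le_ceil _
  have hN2 : ((⌈l * r⌉₊ : ℝ) + 1) ≤ 2 * (l * r) := by
    have := Nat.ceil_lt_add_one (a := l * r) (by positivity)
    linarith
  refine (measure_vacancyEvent_le h hl0.le k r hN hNδ hδr).trans ?_
  set m := l * (Real.pi * (r - δ) ^ 2) with hm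
  have hmμ : m = μ - 4 * Real.pi + l * (Real.pi * δ ^ 2) := by
    rw [hm, ← hrμ]
    linear_combination (-2 * Real.pi) * hlrδ
  have hmle : m ≤ μ := by
    rw [hm, ← hrμ]
    gcongr
    · linarith
  have hm0 : 0 ≤ m := by positivity
  have hq : poissonLT k m ≤ k * (Real.exp (4 * Real.pi) * Real.exp (-μ) * μ ^ (k - 1)) := by
    refine (poissonLT_le_polynomial k hm0 hmle (by linarith)).trans ?_
    rw [← Real.exp_add]
    gcongr
    have : 0 ≤ l * (Real.pi * δ ^ 2) := by positivity
    linarith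
  have hlμ : (l * r) ^ 2 = l * μ / Real.pi := by rw [← hrμ]; field_simp
  have hpow : μ * μ ^ (k - 1) = μ ^ k := by rw [← pow_succ']; congr 1; omega
  have hid := mul_exp_neg_mul_log_pow (k := k) (c := c) hl
  rw [← hLdef, ← hμ] at hid
  calc _ ≤ (2 * (l * r)) ^ 2
        * (k * (Real.exp (4 * Real.pi) * Real.exp (-μ) * μ ^ (k - 1))) := by
        gcongr
        exact poissonLT_nonneg k hm0
    _ = 4 / Real.pi * k * Real.exp (4 * Real.pi) * (l * Real.exp (-μ)) * μ ^ k := by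
        rw [mul_pow, hlμ, ← hpow]; ring
    _ ≤ 4 / Real.pi * k * Real.exp (4 * Real.pi) * (l * Real.exp (-μ)) * ((k + 2) * L) ^ k := by
        gcongr
    _ = _ := by rw [mul_pow, ← hid]; ring

theorem tendsto_measure_vacancyEvent {k : ℕ} (hk : 1 ≤ k) (Ω : ℝ → Type u)
    [∀ l, MeasurableSpace (Ω l)] (P : ∀ l, Measure (Ω l)) [∀ l, IsProbabilityMeasure (P l)]
    (X : ∀ l, ℕ → Ω l → EuclideanSpace ℝ (Fin 2))
    (h : ∀ l, 0 < l → IsStationaryPoissonProcess (X l) l (P l)) (c : ℝ → ℝ)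
    (hc : Tendsto c atTop atTop) :
    Tendsto (fun l => (P l).real (vacancyEvent k (X l) (coverRadius k (c l) l))) atTop (𝓝 0) := by
  -- Capping `c` at `log l` only shrinks the radius, which enlarges the vacancy event, and the
  -- capped value still tends to infinity.
  have hmin : Tendsto (fun l => min (c l) (Real.log l)) atTop atTop :=
    tendsto_inf_atTop _ hc Real.tendsto_log_atTop
  have hlim : Tendsto (fun l => 4 / Real.pi * k * Real.exp (4 * Real.pi) * (k + 2) ^ k
      * Real.exp (-min (c l) (Real.log l))) atTop (𝓝 0) := by
    simpa using (Real.tendsto_exp_neg_atTop_nhds_zero.comp hmin).const_mul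
      (4 / Real.pi * k * Real.exp (4 * Real.pi) * (k + 2) ^ k)
  refine squeeze_zero' (Eventually.of_forall fun _ => measureReal_nonneg) ?_ hlim
  filter_upwards [hmin.eventually_ge_atTop 0, eventually_gt_atTop 1,
    Real.tendsto_log_atTop.eventually_ge_atTop (4 * Real.pi)] with l h0 h1 h2
  have hl : 0 < l := by linarith
  refine le_trans (measureReal_mono (vacancyEvent_antitone k (X l)
    (coverRadius_mono k hl (min_le_left (c l) (Real.log l))))) ?_
  exact measure_vacancyEvent_coverRadius_le (h l hl) hk h1 h2 h0 (min_le_right _ _)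

theorem exists_lt_measure_vacancyEvent {k : ℕ} (hk : 1 ≤ k) (c₀ : ℝ) :
    ∃ c₁ : ℝ, 0 < c₁ ∧ c₁ < 1 ∧
      ∀ (Ω : ℝ → Type u) [∀ l, MeasurableSpace (Ω l)] (P : ∀ l, Measure (Ω l))
        [∀ l, IsProbabilityMeasure (P l)] (X : ∀ l, ℕ → Ω l → EuclideanSpace ℝ (Fin 2)),
        (∀ l, 0 < l → IsStationaryPoissonProcess (X l) l (P l)) →
      ∀ c : ℝ → ℝ, Tendsto c atTop (𝓝 c₀) →
        ∀ᶠ l in atTop, c₁ < (P l).real (vacancyEvent k (X l) (coverRadius k (c l) l)) := by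
  obtain ⟨K, hK, hge⟩ := exists_measure_vacancyEvent_ge.{u} k
  set m := Real.exp (-(c₀ + 1)) / (k - 1).factorial with hm
  have hm0 : 0 < m := by positivity
  have hKpi : 0 < K * Real.pi := by positivity
  have hlt1 : m / (m + K * Real.pi) < 1 := by rw [div_lt_one (by positivity)]; linarith
  have hpos : 0 < m / (m + K * Real.pi) := by positivity
  -- Halving turns the final non-strict bound into a strict one.
  refine ⟨m / (m + K * Real.pi) / 2, by positivity, by linarith, ?_⟩
  intro Ω _ P _ X h c hc
  have hloglog := Real.tendsto_log_atTop.comp Real.tendsto_log_atTop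
  filter_upwards [hc.eventually_le_const (lt_add_one c₀), hc.eventually_const_le (sub_one_lt c₀),
    eventually_gt_atTop 1, hloglog.eventually_ge_atTop 0,
    hloglog.eventually_ge_atTop (1 - c₀)] with l hc1 hc2 hl h0 h1
  simp only [Function.comp_apply] at h0 h1
  have hl0 : 0 < l := by linarith
  have hid := mul_exp_neg_mul_log_pow (k := k) (c := c l) hl
  set L := Real.log l with hLdef
  have hL0 : 0 < L := Real.log_pos hl
  set μ := L + k * Real.log L + c l with hμ
  -- Eventually `log log l ≥ 1 - c₀ ≥ -c l`, which absorbs a negative `c l`.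
  have hLμ : L ≤ μ := by
    have h2 : Real.log L ≤ k * Real.log L := le_mul_of_one_le_left h0 (by exact_mod_cast hk)
    linarith
  have hμ0 : 0 < μ := by linarith
  set r := coverRadius k (c l) l with hr
  have hrμ : l * (Real.pi * r ^ 2) = μ := mul_coverRadius_sq hl0 hμ0.le
  have hr0 : 0 < r := by
    rw [hr, coverRadius]
    exact Real.sqrt_pos.2 (by positivity)
  have hterm := poissonLT_ge_term (k := k) (j := k - 1) (by omega) hμ0.le
  have hp : 0 < poissonLT k μ := lt_of_lt_of_le (by positivity) hterm
  have hmain := hge (Ω l) (X l) l (P l) (h l hl0) hl0 r hr0 (by rwa [hrμ])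
  have hlμ : (l * r) ^ 2 = l * μ / Real.pi := by rw [← hrμ]; field_simp
  rw [hrμ, hlμ] at hmain
  set p := poissonLT k μ with hpdef
  set R := (P l).real (vacancyEvent k (X l) r) with hR
  have hpow : μ * μ ^ (k - 1) = μ ^ k := by rw [← pow_succ']; congr 1; omega
  have hw : m ≤ p * (l * μ) := by
    calc m ≤ Real.exp (-c l) / (k - 1).factorial := by rw [hm]; gcongr
      _ = l * Real.exp (-μ) * L ^ k / (k - 1).factorial := by rw [hid]
      _ ≤ l * Real.exp (-μ) * μ ^ k / (k - 1).factorial := by gcongr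
      _ = Real.exp (-μ) * μ ^ (k - 1) / (k - 1).factorial * (l * μ) := by rw [← hpow]; ring
      _ ≤ p * (l * μ) := by gcongr
  have hRw : p * (l * μ) ≤ R * (p * (l * μ) + K * Real.pi) := by
    have h3 := mul_le_mul_of_nonneg_right hmain (by positivity : 0 ≤ l * μ)
    calc _ ≤ _ := h3
      _ = _ := by field_simp
  have hR1 : R ≤ 1 := measureReal_le_one
  -- With `w = p * (l * μ)`, `hRw` reads `w (1 - R) ≤ R K π`; as `R ≤ 1`, the smaller `m` may
  -- replace `w`.
  have hfin : m / (m + K * Real.pi) ≤ R := by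
    rw [div_le_iff₀ (by positivity)]
    nlinarith
  linarith

theorem theorem4 (k : ℕ) (hk : 1 ≤ k) :
    (∀ (Ω : ℝ → Type u) [∀ l, MeasurableSpace (Ω l)] (P : ∀ l, Measure (Ω l))
        [∀ l, IsProbabilityMeasure (P l)] (X : ∀ l, ℕ → Ω l → EuclideanSpace ℝ (Fin 2)),
        (∀ l, 0 < l → IsStationaryPoissonProcess (X l) l (P l)) →
      ∀ c : ℝ → ℝ, Tendsto c atTop atTop →
        Tendsto (fun l => (P l).real (vacancyEvent k (X l) (coverRadius k (c l) l))) atTop (𝓝 0))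
    ∧
    (∀ c₀ : ℝ, ∃ c₁ : ℝ, 0 < c₁ ∧ c₁ < 1 ∧
      ∀ (Ω : ℝ → Type u) [∀ l, MeasurableSpace (Ω l)] (P : ∀ l, Measure (Ω l))
        [∀ l, IsProbabilityMeasure (P l)] (X : ∀ l, ℕ → Ω l → EuclideanSpace ℝ (Fin 2)),
        (∀ l, 0 < l → IsStationaryPoissonProcess (X l) l (P l)) →
      ∀ c : ℝ → ℝ, Tendsto c atTop (𝓝 c₀) →
        ∀ᶠ l in atTop, c₁ < (P l).real (vacancyEvent k (X l) (coverRadius k (c l) l))) :=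
  ⟨fun Ω _ P _ X h c hc => tendsto_measure_vacancyEvent hk Ω P X h c hc,
    fun c₀ => exists_lt_measure_vacancyEvent hk c₀⟩
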